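/- A \emph{polygraph} $P$ consists of a small strict $\omega$-category $P^*$ together with sets $P_n \subseteq P^*_n$ of $n$-cells ($n \in \mathbb{N}$), the \emph{$n$-generators}, such that $P_0 = P^*_0$ is the set of all objects of $P^*$ and, for every $n \geq 0$, the underlying $(n+1)$-category of $P^*$ is freely generated by $P_{n+1}$ over the underlying $n$-category of $P^*$. A morphism of polygraphs is an $\omega$-functor mapping $n$-generators to $n$-generators for every $n$. For $n \geq 1$, an $n$-cell $x$ is \emph{many-to-one} if its target $\mathsf{t}x$ is an $(n-1)$-generator, and two $n$-cells are \emph{parallel} if they have the same source and the same target; all $0$-cells are many-to-one, and any two $0$-cells are parallel. A polygraph is \emph{many-to-one} if all its generators are; let $\mathrm{Pol}_{\mathrm{mto}}$ be the full subcategory of the category of polygraphs spanned by the many-to-one polygraphs. There exists a polygraph $\mathfrak{1}$ with exactly one $0$-generator and such that, for every $n \geq 0$, the map $x \mapsto (\mathsf{s}x, \mathsf{t}x)$ is a bijection from $\mathfrak{1}_{n+1}$ onto the set of pairs $(u, v)$, where $u$ is a many-to-one $n$-cell of $\mathfrak{1}$, $v \in \mathfrak{1}_n$ is an $n$-generator,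 and $u$ and $v$ are parallel; that is, its $(n+1)$-generators are the pairs $(u,v)$ of this kind, with source $u$ and target $v$. Moreover, every polygraph $\mathfrak{1}$ with these properties is many-to-one and is a terminal object of $\mathrm{Pol}_{\mathrm{mto}}$. -/

import Mathlib

open CategoryTheory

universe u

/-- A small strict `ω`-category, in the single-sorted presentation.  There is one set `Cell` of
cells, and for every `n` a source `src n`, a target `tgt n` and a composition `x ∘_n y`
(`comp n x y`), defined when `src n x = tgt n y`.  The `n`-cells are the cells with
`src n x = x` (see `IsCell`); thus an `n`-cell is identified with the identity `(n+1)`-cell on it,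
and for an `(n+1)`-cell `x`, the cells `src n x` and `tgt n x` are its source and target.  The
axioms say that for each `n` one has a category with objects the `n`-cells, that for each pair
`m < n` one has a strict 2-category, and that every cell has some finite dimension. -/
structure StrictOmegaCat where
  Cell : Type u
  src : ℕ → Cell → Cell
  tgt : ℕ → Cell → Cell
  comp : (n : ℕ) → (x y : Cell) → src n x = tgt n y → Cell
  /- `m`-dimensional sources and targets are `n`-cells for `m ≤ n` -/
  src_src_of_le : ∀ {m n : ℕ}, m ≤ n → ∀ x, src n (src m x) = src m x
  src_tgt_of_le : ∀ {m n : ℕ}, m ≤ n → ∀ x, src n (tgt m x) = tgt m x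
  tgt_src_of_le : ∀ {m n : ℕ}, m ≤ n → ∀ x, tgt n (src m x) = src m x
  tgt_tgt_of_le : ∀ {m n : ℕ}, m ≤ n → ∀ x, tgt n (tgt m x) = tgt m x
  /- globularity -/
  src_src_of_lt : ∀ {m n : ℕ}, m < n → ∀ x, src m (src n x) = src m x
  src_tgt_of_lt : ∀ {m n : ℕ}, m < n → ∀ x, src m (tgt n x) = src m x
  tgt_src_of_lt : ∀ {m n : ℕ}, m < n → ∀ x, tgt m (src n x) = tgt m x
  tgt_tgt_of_lt : ∀ {m n : ℕ}, m < n → ∀ x, tgt m (tgt n x) = tgt m x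
  /- each composition is a category -/
  src_comp : ∀ (n : ℕ) (x y : Cell) (h : src n x = tgt n y), src n (comp n x y h) = src n y
  tgt_comp : ∀ (n : ℕ) (x y : Cell) (h : src n x = tgt n y), tgt n (comp n x y h) = tgt n x
  comp_src : ∀ (n : ℕ) (x : Cell),
    comp n x (src n x) (tgt_src_of_le le_rfl x).symm = x
  tgt_comp_self : ∀ (n : ℕ) (x : Cell),
    comp n (tgt n x) x (src_tgt_of_le le_rfl x) = x
  comp_assoc : ∀ (n : ℕ) (x y z : Cell) (h : src n x = tgt n y) (h' : src n y = tgt n z),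
    comp n (comp n x y h) z ((src_comp n x y h).trans h') =
      comp n x (comp n y z h') (h.trans (tgt_comp n y z h').symm)
  /- `n`-sources and `n`-targets are functorial for `m`-composition, `m < n` -/
  src_comp_of_lt : ∀ {m n : ℕ} (hmn : m < n) (x y : Cell) (h : src m x = tgt m y),
    src n (comp m x y h) = comp m (src n x) (src n y)
      (by rw [src_src_of_lt hmn, tgt_src_of_lt hmn, h])
  tgt_comp_of_lt : ∀ {m n : ℕ} (hmn : m < n) (x y : Cell) (h : src m x = tgt m y),
    tgt n (comp m x y h) = comp m (tgt n x) (tgt n y)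
      (by rw [src_tgt_of_lt hmn, tgt_tgt_of_lt hmn, h])
  /- the exchange law -/
  exchange : ∀ {m n : ℕ} (hmn : m < n) (x x' y y' : Cell)
    (hx : src n x = tgt n x') (hy : src n y = tgt n y') (h : src m x = tgt m y),
    comp m (comp n x x' hx) (comp n y y' hy)
        (by rw [← src_src_of_lt hmn, src_comp, ← tgt_tgt_of_lt hmn (comp n y y' hy), tgt_comp,
              src_src_of_lt hmn, tgt_tgt_of_lt hmn, ← h, ← src_tgt_of_lt hmn x', ← hx,
              src_src_of_lt hmn]) =
      comp n (comp m x y h)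
        (comp m x' y'
          (by rw [← src_tgt_of_lt hmn x', ← hx, src_src_of_lt hmn, h, ← tgt_tgt_of_lt hmn y',
                ← hy, tgt_src_of_lt hmn]))
        (by rw [src_comp_of_lt hmn, tgt_comp_of_lt hmn]; simp only [hx, hy])
  finite_dim : ∀ x, ∃ n, src n x = x

namespace StrictOmegaCat

/-- `x` is an `n`-cell (identities of lower-dimensional cells included). -/
def IsCell (C : StrictOmegaCat.{u}) (n : ℕ) (x : C.Cell) : Prop := C.src n x = x

/-- Two `n`-cells are parallel when they have the same source and the same target; any two
`0`-cells are parallel. -/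
def Parallel (C : StrictOmegaCat.{u}) : ℕ → C.Cell → C.Cell → Prop
  | 0, _, _ => True
  | n + 1, x, y => C.src n x = C.src n y ∧ C.tgt n x = C.tgt n y

/-- `C` is an `n`-category: all its cells are `n`-cells (that is, all higher cells are
identities). -/
def IsNCategory (C : StrictOmegaCat.{u}) (n : ℕ) : Prop := ∀ x, C.IsCell n x

theorem IsCell.tgt_eq {C : StrictOmegaCat.{u}} {n : ℕ} {x : C.Cell} (h : C.IsCell n x) :
    C.tgt n x = x := by
  have := C.tgt_src_of_le (le_refl n) x
  rwa [show C.src n x = x from h] at this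

theorem IsCell.mono {C : StrictOmegaCat.{u}} {m n : ℕ} (hmn : m ≤ n) {x : C.Cell}
    (h : C.IsCell m x) : C.IsCell n x := by
  have := C.src_src_of_le hmn x
  rwa [show C.src m x = x from h] at this

theorem IsCell.src {C : StrictOmegaCat.{u}} {n : ℕ} (k : ℕ) {x : C.Cell} (h : C.IsCell n x) :
    C.IsCell n (C.src k x) := by
  rcases le_total k n with hk | hk
  · exact C.src_src_of_le hk x
  · rw [show C.src k x = x from h.mono hk]; exact h

theorem IsCell.tgt {C : StrictOmegaCat.{u}} {n : ℕ} (k : ℕ) {x : C.Cell} (h : C.IsCell n x) :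
    C.IsCell n (C.tgt k x) := by
  rcases le_total k n with hk | hk
  · exact C.src_tgt_of_le hk x
  · rw [(h.mono hk).tgt_eq]; exact h

theorem IsCell.comp {C : StrictOmegaCat.{u}} {n : ℕ} (k : ℕ) {x y : C.Cell} (hx : C.IsCell n x)
    (hy : C.IsCell n y) (h : C.src k x = C.tgt k y) : C.IsCell n (C.comp k x y h) := by
  rcases lt_or_ge k n with hk | hk
  · have := C.src_comp_of_lt hk x y h
    simp only [show C.src n x = x from hx, show C.src n y = y from hy] at this
    exact this
  · have h1 : C.src k x = x := hx.mono hk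
    have h2 : C.tgt k y = y := (hy.mono hk).tgt_eq
    have hxy : y = C.src k x := by rw [h, h2]
    subst hxy
    rw [C.comp_src]; exact hx

/-- The underlying `n`-category `C|_n` of an `ω`-category `C`: its cells are the `n`-cells
of `C`. -/
def trunc (C : StrictOmegaCat.{u}) (n : ℕ) : StrictOmegaCat.{u} where
  Cell := {x : C.Cell // C.IsCell n x}
  src k x := ⟨C.src k x.1, x.2.src k⟩
  tgt k x := ⟨C.tgt k x.1, x.2.tgt k⟩
  comp k x y h := ⟨C.comp k x.1 y.1 (congrArg Subtype.val h), x.2.comp k y.2 _⟩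
  src_src_of_le h x := Subtype.ext (C.src_src_of_le h x.1)
  src_tgt_of_le h x := Subtype.ext (C.src_tgt_of_le h x.1)
  tgt_src_of_le h x := Subtype.ext (C.tgt_src_of_le h x.1)
  tgt_tgt_of_le h x := Subtype.ext (C.tgt_tgt_of_le h x.1)
  src_src_of_lt h x := Subtype.ext (C.src_src_of_lt h x.1)
  src_tgt_of_lt h x := Subtype.ext (C.src_tgt_of_lt h x.1)
  tgt_src_of_lt h x := Subtype.ext (C.tgt_src_of_lt h x.1)
  tgt_tgt_of_lt h x := Subtype.ext (C.tgt_tgt_of_lt h x.1)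
  src_comp k _ _ _ := Subtype.ext (C.src_comp k _ _ _)
  tgt_comp k _ _ _ := Subtype.ext (C.tgt_comp k _ _ _)
  comp_src k x := Subtype.ext (C.comp_src k x.1)
  tgt_comp_self k x := Subtype.ext (C.tgt_comp_self k x.1)
  comp_assoc k _ _ _ h h' :=
    Subtype.ext (C.comp_assoc k _ _ _ (congrArg Subtype.val h) (congrArg Subtype.val h'))
  src_comp_of_lt hmn _ _ h := Subtype.ext (C.src_comp_of_lt hmn _ _ (congrArg Subtype.val h))
  tgt_comp_of_lt hmn _ _ h := Subtype.ext (C.tgt_comp_of_lt hmn _ _ (congrArg Subtype.val h))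
  exchange hmn _ _ _ _ hx hy h :=
    Subtype.ext (C.exchange hmn _ _ _ _ (congrArg Subtype.val hx) (congrArg Subtype.val hy)
      (congrArg Subtype.val h))
  finite_dim x := ⟨n, Subtype.ext x.2⟩

/-- The inclusion of the `n`-cells into the `(n+1)`-cells. -/
def incl (C : StrictOmegaCat.{u}) (n : ℕ) (x : (C.trunc n).Cell) : (C.trunc (n + 1)).Cell :=
  ⟨x.1, x.2.mono (Nat.le_succ n)⟩

end StrictOmegaCat

/-- A strict `ω`-functor: a map on cells that preserves sources, targets and compositions
(identities are preserved automatically, being the cells fixed by a source map). -/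
@[ext]
structure StrictOmegaFunctor (C D : StrictOmegaCat.{u}) where
  map : C.Cell → D.Cell
  map_src : ∀ (n : ℕ) (x : C.Cell), map (C.src n x) = D.src n (map x)
  map_tgt : ∀ (n : ℕ) (x : C.Cell), map (C.tgt n x) = D.tgt n (map x)
  map_comp : ∀ (n : ℕ) (x y : C.Cell) (h : C.src n x = C.tgt n y),
    map (C.comp n x y h) = D.comp n (map x) (map y) (by rw [← map_src, ← map_tgt, h])

/-- The underlying `(n+1)`-category of `C` is freely generated by the set `G` of `(n+1)`-cells
over the underlying `n`-category of `C`: for every `(n+1)`-category `D`, an `n`-functor `F` from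
the `n`-category `C|_n` to `D` (it automatically takes its values in `n`-cells) and a choice `φ` of
an `(n+1)`-cell of `D` for each element of `G`, with source and target prescribed by `F`, extend
jointly to exactly one `(n+1)`-functor from `C|_{n+1}` to `D`. -/
def StrictOmegaCat.FreelyGenerated (C : StrictOmegaCat.{u}) (n : ℕ)
    (G : Set (C.trunc (n + 1)).Cell) : Prop :=
  ∀ (D : StrictOmegaCat.{u}), D.IsNCategory (n + 1) →
    ∀ (F : StrictOmegaFunctor (C.trunc n) D) (φ : G → D.Cell),
      (∀ g : G, D.src n (φ g) = F.map ⟨C.src n g.1.1, C.src_src_of_le le_rfl _⟩) →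
      (∀ g : G, D.tgt n (φ g) = F.map ⟨C.tgt n g.1.1, C.src_tgt_of_le le_rfl _⟩) →
      ∃! H : StrictOmegaFunctor (C.trunc (n + 1)) D,
        (∀ x : (C.trunc n).Cell, H.map (C.incl n x) = F.map x) ∧ (∀ g : G, H.map g.1 = φ g)

/-- A polygraph `P`: a small strict `ω`-category `P*` (here `P.cat`) with a set `P_n`
(here `P.gen n`) of `n`-cells for every `n`, the `n`-generators, such that `P_0` is the set of
all `0`-cells and, for every `n`, the underlying `(n+1)`-category of `P*` is freely generated by
`P_{n+1}` over its underlying `n`-category. -/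
structure Polygraph where
  cat : StrictOmegaCat.{u}
  gen : ℕ → Set cat.Cell
  isCell_of_mem_gen : ∀ (n : ℕ), ∀ x ∈ gen n, cat.IsCell n x
  mem_gen_zero : ∀ x, cat.IsCell 0 x → x ∈ gen 0
  free : ∀ n : ℕ, cat.FreelyGenerated n {x | x.1 ∈ gen (n + 1)}

namespace Polygraph

/-- A morphism of polygraphs: an `ω`-functor mapping `n`-generators to `n`-generators. -/
@[ext]
structure Hom (P Q : Polygraph.{u}) extends StrictOmegaFunctor P.cat Q.cat where
  map_gen : ∀ (n : ℕ), ∀ x ∈ P.gen n, map x ∈ Q.gen n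

/-- The category of polygraphs. -/
instance : Category Polygraph.{u} where
  Hom P Q := Hom P Q
  id P :=
    { map := fun x => x
      map_src := fun _ _ => rfl
      map_tgt := fun _ _ => rfl
      map_comp := fun _ _ _ _ => rfl
      map_gen := fun _ _ h => h }
  comp f g :=
    { map := fun x => g.map (f.map x)
      map_src := fun n x => by rw [f.map_src, g.map_src]
      map_tgt := fun n x => by rw [f.map_tgt, g.map_tgt]
      map_comp := fun n x y h => by rw [f.map_comp, g.map_comp]
      map_gen := fun n x h => g.map_gen n _ (f.map_gen n x h) }

/-- A many-to-one `n`-cell of `P`: for `n ≥ 1`, an `n`-cell whose target is an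
`(n-1)`-generator; all `0`-cells are many-to-one. -/
def IsManyToOneCell (P : Polygraph.{u}) : ℕ → P.cat.Cell → Prop
  | 0, x => P.cat.IsCell 0 x
  | n + 1, x => P.cat.IsCell (n + 1) x ∧ P.cat.tgt n x ∈ P.gen n

/-- A polygraph is many-to-one when all its generators are. -/
def IsManyToOne : ObjectProperty Polygraph.{u} :=
  fun P => ∀ (n : ℕ), ∀ x ∈ P.gen n, P.IsManyToOneCell n x

/-- `P` is (a copy of) the polygraph `𝟙`: it has exactly one `0`-generator, and
`x ↦ (source of x, target of x)` identifies its set of `(n+1)`-generators with the set of pairs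
`(u, v)` of a many-to-one `n`-cell `u` and an `n`-generator `v` that are parallel.  Together with
the freeness in the definition of a polygraph, this determines `P` by induction on `n`. -/
structure IsOne (P : Polygraph.{u}) : Prop where
  existsUnique_gen_zero : ∃! x, x ∈ P.gen 0
  bijOn_gen_succ : ∀ n : ℕ,
    Set.BijOn (fun x => (P.cat.src n x, P.cat.tgt n x)) (P.gen (n + 1))
      {p | P.IsManyToOneCell n p.1 ∧ p.2 ∈ P.gen n ∧ P.cat.Parallel n p.1 p.2}

end Polygraph

/-- The category of many-to-one polygraphs, a full subcategory of the category of polygraphs. -/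
abbrev PolMTO := Polygraph.IsManyToOne.{u}.FullSubcategory

/-!
The polygraph `𝟙` is built in one step, as a term model, rather than dimension by dimension.  Its
raw terms `OneTerm` are made from one object by formal generators `gen n u v`, where `u` and `v` are
terms, and formal composites.  Sources and targets (`OneTerm.bd`) are computed by recursion on
terms, and the partial equivalence relation `OneTerm.Rel`, generated by the category laws and the
exchange law, says at once which terms denote cells and which terms denote the same cell.  The
generators of all dimensions can be introduced together because the condition on a pair
`(u, v)` to be a generator (`u` is of dimension at most `n`, `v` is written as an `n`-generator,
and their lower boundaries are related) occurs only positively.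

Almost all laws of sources and targets hold for raw terms literally.  The exception is the
globularity `s t = s`, `t s = t`; it is proved jointly with the compatibility of boundaries with
`Rel` (`Rel.bd_and_glob`).  Related terms have the same dimension (`Rel.dim_eq`), so that a cell is
an `n`-cell exactly when its terms involve generators of dimension at most `n` only
(`cellBd_mk_eq_self_iff`); this is what identifies the underlying `n`-category and makes freeness
a statement about interpreting terms.  Given a functor on the `n`-cells and values at the
`(n+1)`-generators, `interp` evaluates terms, and `Rel.interp_eq` shows by induction on `Rel` that
the value depends on the cell only and is compatible with boundaries.  As formal
generators are identified as soon as their sources and their targets are, the `(n+1)`-generators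
are in bijection with the pairs `(u, v)` (`polygraph_isOne`).

For terminality, let `x` be an `(n+1)`-generator of a many-to-one polygraph `Q`.  Its target is a
generator, and its source, being parallel to that many-to-one cell, is many-to-one too.  Hence a
functor to `𝟙` that is defined on the `n`-cells of `Q` and preserves `n`-generators sends the source
and the target of `x` to a pair indexing exactly one `(n+1)`-generator of `𝟙`.  By freeness of `Q`
there is exactly one extension to `(n+1)`-cells that preserves generators
(`Polygraph.IsOne.exists_extension`, `Polygraph.IsOne.hom_ext`), and these extensions are glued
along `n`.
-/

/-! ### Terms and their boundaries -/

/-- Raw terms for the cells of `𝟙`: the object `pt`, a generator `gen n u v` of dimension `n + 1`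
with source `u` and target `v`, and the composite `comp k x y` of `x` after `y` along their common
`k`-boundary.  Identities are not written, an `n`-cell being its own identity.  Which terms denote
cells, and which of them denote the same cell, is decided by `OneTerm.Rel`. -/
inductive OneTerm : Type u
  | pt
  | gen (n : ℕ) (u v : OneTerm)
  | comp (k : ℕ) (x y : OneTerm)

namespace OneTerm

/-- The dimension of a term, the largest dimension of a generator in it. -/
def dim : OneTerm.{u} → ℕ
  | pt => 0
  | gen n _ _ => n + 1
  | comp _ x y => max x.dim y.dim

/-- The `k`-dimensional source (`e = false`) or target (`e = true`) of a term. -/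
def bd (e : Bool) (k : ℕ) : OneTerm.{u} → OneTerm.{u}
  | pt => pt
  | gen n u v => if k ≤ n then (match e with | false => bd e k u | true => bd e k v) else gen n u v
  | comp m x y =>
    if k ≤ m then (match e with | false => bd e k y | true => bd e k x)
    else comp m (bd e k x) (bd e k y)

/-- `IsGen n x` says that the term `x` is written as an `n`-generator. -/
def IsGen : ℕ → OneTerm.{u} → Prop
  | 0, pt => True
  | n + 1, gen m _ _ => m = n
  | _, _ => False

theorem bd_gen_of_le {e : Bool} {k n : ℕ} (h : k ≤ n) (u v : OneTerm.{u}) :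
    bd e k (gen n u v) = bd e k (cond e v u) := by
  cases e <;> simp [bd, h]

theorem bd_gen_of_lt {e : Bool} {k n : ℕ} (h : n < k) (u v : OneTerm.{u}) :
    bd e k (gen n u v) = gen n u v := by
  cases e <;> simp [bd, h]

theorem bd_comp_of_le {e : Bool} {k n : ℕ} (h : k ≤ n) (x y : OneTerm.{u}) :
    bd e k (comp n x y) = bd e k (cond e x y) := by
  cases e <;> simp [bd, h]

theorem bd_comp_of_lt {e : Bool} {k n : ℕ} (h : n < k) (x y : OneTerm.{u}) :
    bd e k (comp n x y) = comp n (bd e k x) (bd e k y) := by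
  cases e <;> simp [bd, h]

theorem bd_bd_of_le {e e' : Bool} {k j : ℕ} (h : k ≤ j) (x : OneTerm.{u}) :
    bd e' j (bd e k x) = bd e k x := by
  induction x with
  | pt => rfl
  | gen n u v ihu ihv =>
    rcases le_or_gt k n with hk | hk
    · rw [bd_gen_of_le hk]; cases e <;> assumption
    · rw [bd_gen_of_lt hk, bd_gen_of_lt (hk.trans_le h)]
  | comp n x y ihx ihy =>
    rcases le_or_gt k n with hk | hk
    · rw [bd_comp_of_le hk]; cases e <;> assumption
    · rw [bd_comp_of_lt hk, bd_comp_of_lt (hk.trans_le h), ihx, ihy]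

theorem bd_bd_self {e : Bool} {k j : ℕ} (h : k ≤ j) (x : OneTerm.{u}) :
    bd e k (bd e j x) = bd e k x := by
  induction x with
  | pt => rfl
  | gen n u v ihu ihv =>
    rcases le_or_gt j n with hj | hj
    · rw [bd_gen_of_le hj, bd_gen_of_le (h.trans hj)]; cases e <;> assumption
    · rw [bd_gen_of_lt hj]
  | comp n x y ihx ihy =>
    rcases le_or_gt j n with hj | hj
    · rw [bd_comp_of_le hj, bd_comp_of_le (h.trans hj)]; cases e <;> assumption
    · rw [bd_comp_of_lt hj]
      rcases le_or_gt k n with hk | hk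
      · rw [bd_comp_of_le hk, bd_comp_of_le hk]; cases e <;> assumption
      · rw [bd_comp_of_lt hk, bd_comp_of_lt hk, ihx, ihy]

theorem bd_zero (e : Bool) (x : OneTerm.{u}) : bd e 0 x = pt := by
  induction x with
  | pt => rfl
  | gen n u v ihu ihv => rw [bd_gen_of_le (Nat.zero_le n)]; cases e <;> assumption
  | comp n x y ihx ihy => rw [bd_comp_of_le (Nat.zero_le n)]; cases e <;> assumption

theorem dim_bd_le (e : Bool) (k : ℕ) (x : OneTerm.{u}) : (bd e k x).dim ≤ k := by
  induction x with
  | pt => exact Nat.zero_le k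
  | gen n u v ihu ihv =>
    rcases le_or_gt k n with hk | hk
    · rw [bd_gen_of_le hk]; cases e <;> assumption
    · rw [bd_gen_of_lt hk]; exact hk
  | comp n x y ihx ihy =>
    rcases le_or_gt k n with hk | hk
    · rw [bd_comp_of_le hk]; cases e <;> assumption
    · rw [bd_comp_of_lt hk]; exact max_le ihx ihy

theorem dim_bd_le_dim (e : Bool) (k : ℕ) (x : OneTerm.{u}) : (bd e k x).dim ≤ x.dim := by
  induction x with
  | pt => exact le_rfl
  | gen n u v ihu ihv =>
    rcases le_or_gt k n with hk | hk
    · rw [bd_gen_of_le hk]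
      exact (dim_bd_le e k _).trans (hk.trans (Nat.le_succ n))
    · rw [bd_gen_of_lt hk]
  | comp n x y ihx ihy =>
    rcases le_or_gt k n with hk | hk
    · rw [bd_comp_of_le hk]
      cases e
      · exact ihy.trans (le_max_right _ _)
      · exact ihx.trans (le_max_left _ _)
    · rw [bd_comp_of_lt hk]; exact max_le_max ihx ihy

theorem IsGen.dim_eq {n : ℕ} {x : OneTerm.{u}} (h : IsGen n x) : x.dim = n := by
  cases n <;> cases x <;> simp_all [IsGen, dim]

theorem IsGen.bd_eq {n : ℕ} {x : OneTerm.{u}} (h : IsGen n x) (e : Bool) {k : ℕ} (hk : n ≤ k) :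
    bd e k x = x := by
  cases x with
  | pt => rfl
  | gen m u v =>
    exact bd_gen_of_lt (lt_of_lt_of_le (Nat.lt_succ_self m) (h.dim_eq.trans_le hk)) u v
  | comp m x y => cases n <;> exact h.elim

/-! ### Well-formed terms and their identification -/

/-- The partial equivalence relation on terms generated by the laws of strict `ω`-categories.
A term denotes a cell of `𝟙` when it is related to itself, and two terms denote the same cell
when they are related.  The rule `gen` admits a generator exactly for each pair of a term `u` of
dimension at most `n` and a parallel `n`-generator `v`; that `u` is then many-to-one is automatic.
Each of the laws has as premises that its two sides denote cells, so that inductions over `Rel`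
need not deal with well-formedness in these cases.  For the same reason the congruence rules ask
only the left-hand side to be composable or parallel; for the right-hand side it follows. -/
inductive Rel : OneTerm.{u} → OneTerm.{u} → Prop
  | pt : Rel pt pt
  | gen {n : ℕ} {u u' v v' : OneTerm.{u}} : Rel u u' → Rel v v' → u.dim ≤ n → u'.dim ≤ n →
      IsGen n v → IsGen n v' → (∀ e k, k < n → Rel (bd e k u) (bd e k v)) →
      Rel (gen n u v) (gen n u' v')
  | comp {k : ℕ} {x x' y y' : OneTerm.{u}} : Rel x x' → Rel y y' →
      Rel (bd false k x) (bd true k y) → Rel (comp k x y) (comp k x' y')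
  | symm {x y : OneTerm.{u}} : Rel x y → Rel y x
  | trans {x y z : OneTerm.{u}} : Rel x y → Rel y z → Rel x z
  | comp_src {k : ℕ} {x : OneTerm.{u}} : Rel (comp k x (bd false k x)) (comp k x (bd false k x)) →
      Rel x x → Rel (comp k x (bd false k x)) x
  | tgt_comp {k : ℕ} {x : OneTerm.{u}} : Rel (comp k (bd true k x) x) (comp k (bd true k x) x) →
      Rel x x → Rel (comp k (bd true k x) x) x
  | assoc {k : ℕ} {x y z : OneTerm.{u}} :
      Rel (comp k (comp k x y) z) (comp k (comp k x y) z) →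
      Rel (comp k x (comp k y z)) (comp k x (comp k y z)) →
      Rel (comp k (comp k x y) z) (comp k x (comp k y z))
  | exchange {m n : ℕ} {x x' y y' : OneTerm.{u}} : m < n →
      Rel (comp m (comp n x x') (comp n y y')) (comp m (comp n x x') (comp n y y')) →
      Rel (comp n (comp m x y) (comp m x' y')) (comp n (comp m x y) (comp m x' y')) →
      Rel (comp m (comp n x x') (comp n y y')) (comp n (comp m x y) (comp m x' y'))

theorem Rel.left {x y : OneTerm.{u}} (h : Rel x y) : Rel x x := h.trans h.symm

theorem Rel.right {x y : OneTerm.{u}} (h : Rel x y) : Rel y y := h.symm.trans h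

theorem Rel.dim_eq {x y : OneTerm.{u}} (h : Rel x y) : x.dim = y.dim := by
  induction h with
  | pt => rfl
  | gen => rfl
  | comp _ _ _ h1 h2 => simp only [dim, h1, h2]
  | symm _ h => exact h.symm
  | trans _ _ h1 h2 => exact h1.trans h2
  | comp_src => exact max_eq_left (dim_bd_le_dim _ _ _)
  | tgt_comp => exact max_eq_right (dim_bd_le_dim _ _ _)
  | assoc => exact max_assoc _ _ _
  | exchange => exact max_max_max_comm _ _ _ _

/-- What well-formedness means at the root of a term. -/
def Inv : OneTerm.{u} → Prop
  | OneTerm.pt => True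
  | OneTerm.gen n u v => Rel u u ∧ Rel v v ∧ u.dim ≤ n ∧ IsGen n v
  | OneTerm.comp _ x y => Rel x x ∧ Rel y y

/-- The terms of which the given one is composed are well-formed. -/
theorem Rel.inv {x y : OneTerm.{u}} (h : Rel x y) : Inv x ∧ Inv y := by
  induction h with
  | pt => exact ⟨trivial, trivial⟩
  | gen hu hv du du' gv gv' _ _ _ =>
    exact ⟨⟨hu.left, hv.left, du, gv⟩, ⟨hu.right, hv.right, du', gv'⟩⟩
  | comp hx hy _ _ _ _ => exact ⟨⟨hx.left, hy.left⟩, ⟨hx.right, hy.right⟩⟩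
  | symm _ h => exact h.symm
  | trans _ _ h1 h2 => exact ⟨h1.1, h2.2⟩
  | comp_src _ _ h1 h2 => exact ⟨h1.1, h2.1⟩
  | tgt_comp _ _ h1 h2 => exact ⟨h1.1, h2.1⟩
  | assoc _ _ h1 h2 => exact ⟨h1.1, h2.1⟩
  | exchange _ _ _ h1 h2 => exact ⟨h1.1, h2.1⟩

/-- Globularity of a term: taking a higher boundary first does not change a lower one. -/
def Glob (x : OneTerm.{u}) : Prop :=
  ∀ (e e' : Bool) (k j : ℕ), k < j → Rel (bd e k (bd e' j x)) (bd e k x)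

/-- Lower boundaries of composable terms agree. -/
theorem Glob.rel_bd_of_lt {x y : OneTerm.{u}} {p : ℕ} (gx : Glob x) (gy : Glob y)
    (h : ∀ e k, Rel (bd e k (bd false p x)) (bd e k (bd true p y))) (e : Bool) {k : ℕ}
    (hk : k < p) : Rel (bd e k x) (bd e k y) :=
  ((gx e false k p hk).symm.trans (h e k)).trans (gy e true k p hk)

theorem Glob.comp_bd {x y : OneTerm.{u}} {p : ℕ} (gx : Glob x) (gy : Glob y)
    (h : Rel (bd false p x) (bd true p y)) (e : Bool) {j : ℕ} (hj : p < j) :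
    Rel (bd false p (bd e j x)) (bd true p (bd e j y)) :=
  ((gx false e p j hj).trans h).trans (gy true e p j hj).symm

theorem Glob.comp {x y : OneTerm.{u}} {p : ℕ} (gx : Glob x) (gy : Glob y)
    (hxy : ∀ e k, k < p → Rel (bd e k x) (bd e k y)) (h : Rel (bd false p x) (bd true p y)) :
    Glob (comp p x y) := by
  intro e e' k j hkj
  rcases le_or_gt j p with hj | hj
  · rw [bd_comp_of_le hj, bd_comp_of_le (hkj.le.trans hj)]
    have hr := hxy e k (hkj.trans_le hj)
    cases e' <;> cases e
    · exact gy _ _ _ _ hkj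
    · exact (gy _ _ _ _ hkj).trans hr.symm
    · exact (gx _ _ _ _ hkj).trans hr
    · exact gx _ _ _ _ hkj
  · rw [bd_comp_of_lt hj]
    rcases le_or_gt k p with hk | hk
    · rw [bd_comp_of_le hk, bd_comp_of_le hk]
      cases e
      · exact gy _ _ _ _ hkj
      · exact gx _ _ _ _ hkj
    · rw [bd_comp_of_lt hk, bd_comp_of_lt hk]
      -- `Rel.comp` needs composability of its left-hand side only, and for the simpler of the two
      -- composites this follows from the globularity of `x` and `y`
      exact (Rel.comp (gx e e' k j hkj).symm (gy e e' k j hkj).symm (gx.comp_bd gy h e hk)).symm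

theorem Glob.gen {n : ℕ} {u v : OneTerm.{u}} (gu : Glob u) (gv : Glob v)
    (h : ∀ e k, k < n → Rel (bd e k u) (bd e k v))
    (hr : ∀ e k, Rel (bd e k (gen n u v)) (bd e k (gen n u v))) : Glob (gen n u v) := by
  intro e e' k j hkj
  rcases le_or_gt j n with hj | hj
  · rw [bd_gen_of_le hj, bd_gen_of_le (hkj.le.trans hj)]
    have hr := h e k (hkj.trans_le hj)
    cases e' <;> cases e
    · exact gu _ _ _ _ hkj
    · exact (gu _ _ _ _ hkj).trans hr
    · exact (gv _ _ _ _ hkj).trans hr.symm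
    · exact gv _ _ _ _ hkj
  · rw [bd_gen_of_lt hj]; exact hr e k

/-- Boundaries are compatible with `Rel`, and well-formed terms are globular.  Each of the two
facts is needed for the other at composites, whence the joint induction. -/
theorem Rel.bd_and_glob {x y : OneTerm.{u}} (h : Rel x y) :
    (∀ e k, Rel (bd e k x) (bd e k y)) ∧ Glob x ∧ Glob y := by
  induction h with
  | pt => exact ⟨fun _ _ => .pt, fun _ _ _ _ _ => .pt, fun _ _ _ _ _ => .pt⟩
  | @gen n u u' v v' hu hv du du' gv gv' hp ihu ihv ihp =>
    have hp' : ∀ e k, k < n → Rel (bd e k u') (bd e k v') := fun e k hk =>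
      ((ihu.1 e k).symm.trans (hp e k hk)).trans (ihv.1 e k)
    have key : ∀ e k, Rel (OneTerm.bd e k (OneTerm.gen n u v))
        (OneTerm.bd e k (OneTerm.gen n u' v')) := by
      intro e k
      rcases le_or_gt k n with hk | hk
      · rw [bd_gen_of_le hk, bd_gen_of_le hk]
        cases e
        · exact ihu.1 _ _
        · exact ihv.1 _ _
      · rw [bd_gen_of_lt hk, bd_gen_of_lt hk]
        exact .gen hu hv du du' gv gv' hp
    exact ⟨key, ihu.2.1.gen ihv.2.1 hp fun e k => (key e k).left,
      ihu.2.2.gen ihv.2.2 hp' fun e k => (key e k).right⟩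
  | @comp p x x' y y' hx hy h ihx ihy ih =>
    have h' : Rel (bd false p x') (bd true p y') :=
      ((ihx.1 _ _).symm.trans h).trans (ihy.1 _ _)
    have hl : ∀ e k, k < p → Rel (bd e k x) (bd e k y) := fun e k hk =>
      ihx.2.1.rel_bd_of_lt ihy.2.1 ih.1 e hk
    refine ⟨fun e k => ?_, ihx.2.1.comp ihy.2.1 hl h, ihx.2.2.comp ihy.2.2 (fun e k hk =>
      ((ihx.1 e k).symm.trans (hl e k hk)).trans (ihy.1 e k)) h'⟩
    rcases le_or_gt k p with hk | hk
    · rw [bd_comp_of_le hk, bd_comp_of_le hk]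
      cases e
      · exact ihy.1 _ _
      · exact ihx.1 _ _
    · rw [bd_comp_of_lt hk, bd_comp_of_lt hk]
      exact .comp (ihx.1 e k) (ihy.1 e k) (ihx.2.1.comp_bd ihy.2.1 h e hk)
  | symm _ ih => exact ⟨fun e k => (ih.1 e k).symm, ih.2.2, ih.2.1⟩
  | trans _ _ ih ih' => exact ⟨fun e k => (ih.1 e k).trans (ih'.1 e k), ih.2.1, ih'.2.2⟩
  | @comp_src k x _ _ ihl ih =>
    refine ⟨fun e j => ?_, ihl.2.1, ih.2.1⟩
    rcases le_or_gt j k with hj | hj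
    · rw [bd_comp_of_le hj]
      cases e
      · rw [cond_false, bd_bd_self hj]; exact ih.1 _ _
      · exact ih.1 _ _
    · rw [bd_comp_of_lt hj, bd_bd_of_le hj.le]
      have hc : Rel (OneTerm.comp k (bd e j x) (bd false k x))
          (OneTerm.comp k (bd e j x) (bd false k (bd e j x))) :=
        .comp (ih.1 e j) (ih.2.1 _ _ _ _ hj).symm
          (by rw [bd_bd_of_le le_rfl]; exact ih.2.1 _ _ _ _ hj)
      exact hc.trans (.comp_src hc.right (ih.1 e j))
  | @tgt_comp k x _ _ ihl ih =>
    refine ⟨fun e j => ?_, ihl.2.1, ih.2.1⟩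
    rcases le_or_gt j k with hj | hj
    · rw [bd_comp_of_le hj]
      cases e
      · exact ih.1 _ _
      · rw [cond_true, bd_bd_self hj]; exact ih.1 _ _
    · rw [bd_comp_of_lt hj, bd_bd_of_le hj.le]
      have hc : Rel (OneTerm.comp k (bd true k x) (bd e j x))
          (OneTerm.comp k (bd true k (bd e j x)) (bd e j x)) :=
        .comp (ih.2.1 _ _ _ _ hj).symm (ih.1 e j)
          (by rw [bd_bd_of_le le_rfl]; exact (ih.2.1 _ _ _ _ hj).symm)
      exact hc.trans (.tgt_comp hc.right (ih.1 e j))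
  | @assoc k x y z _ _ ihl ihr =>
    refine ⟨fun e j => ?_, ihl.2.1, ihr.2.1⟩
    have hl := ihl.1 e j
    have hr := ihr.1 e j
    rcases le_or_gt j k with hj | hj
    · cases e <;> simpa [bd_comp_of_le hj] using hl
    · simp only [bd_comp_of_lt hj] at hl hr ⊢
      exact .assoc hl hr
  | @exchange m n x x' y y' hmn _ _ ihl ihr =>
    refine ⟨fun e j => ?_, ihl.2.1, ihr.2.1⟩
    have hl := ihl.1 e j
    have hr := ihr.1 e j
    rcases le_or_gt j m with hj | hj
    · cases e <;> simpa [bd_comp_of_le hj, bd_comp_of_le (hj.trans hmn.le)] using hl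
    · rcases le_or_gt j n with hn | hn
      · cases e <;> simpa [bd_comp_of_le hn, bd_comp_of_lt hj] using hl
      · simp only [bd_comp_of_lt hj, bd_comp_of_lt hn] at hl hr ⊢
        exact .exchange hmn hl hr

theorem Rel.bd {x y : OneTerm.{u}} (h : Rel x y) (e : Bool) (k : ℕ) : Rel (bd e k x) (bd e k y) :=
  h.bd_and_glob.1 e k

theorem Rel.glob {x y : OneTerm.{u}} (h : Rel x y) : Glob x := h.bd_and_glob.2.1

/-- Well-formed composites are composable. -/
theorem Rel.composable {x y : OneTerm.{u}} (h : Rel x y) :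
    (∀ k a b, x = OneTerm.comp k a b → Rel (OneTerm.bd false k a) (OneTerm.bd true k b)) ∧
      ∀ k a b, y = OneTerm.comp k a b → Rel (OneTerm.bd false k a) (OneTerm.bd true k b) := by
  induction h with
  | pt => exact ⟨nofun, nofun⟩
  | gen => exact ⟨nofun, nofun⟩
  | comp hx hy h =>
    refine ⟨fun k a b hc => ?_, fun k a b hc => ?_⟩
    · cases hc; exact h
    · cases hc; exact ((hx.bd _ _).symm.trans h).trans (hy.bd _ _)
  | symm _ h => exact h.symm
  | trans _ _ h1 h2 => exact ⟨h1.1, h2.2⟩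
  | comp_src _ _ h1 h2 => exact ⟨h1.1, h2.1⟩
  | tgt_comp _ _ h1 h2 => exact ⟨h1.1, h2.1⟩
  | assoc _ _ h1 h2 => exact ⟨h1.1, h2.1⟩
  | exchange _ _ _ h1 h2 => exact ⟨h1.1, h2.1⟩

/-- A well-formed term of dimension at most `n` is its own `n`-source and `n`-target. -/
theorem Rel.bd_of_dim_le {x : OneTerm.{u}} (h : Rel x x) :
    ∀ (e : Bool) {n : ℕ}, x.dim ≤ n → Rel (OneTerm.bd e n x) x := by
  induction x with
  | pt => exact fun _ _ _ => .pt
  | gen m u v => intro e n hn; rwa [bd_gen_of_lt hn]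
  | comp m x y ihx ihy =>
    intro e n hn
    obtain ⟨hx, hy⟩ := h.inv.1
    have hc := h.composable.1 _ _ _ rfl
    have dx : x.dim ≤ n := (le_max_left _ _).trans hn
    have dy : y.dim ≤ n := (le_max_right _ _).trans hn
    rcases le_or_gt n m with hm | hm
    · -- composing along a dimension that is at least that of the factors is trivial
      have hsy : Rel (OneTerm.bd false m x) y := hc.trans (ihy hy true (dy.trans hm))
      have hxy : Rel x y := (ihx hx false (dx.trans hm)).symm.trans hsy
      have h1 : Rel (OneTerm.comp m x y) (OneTerm.comp m x (OneTerm.bd false m x)) :=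
        .comp hx hsy.symm hc
      have h2 : Rel (OneTerm.comp m x y) x := h1.trans (.comp_src h1.right hx)
      rw [bd_comp_of_le hm]
      cases e
      · exact (ihy hy false dy).trans (hxy.symm.trans h2.symm)
      · exact (ihx hx true dx).trans h2.symm
    · rw [bd_comp_of_lt hm]
      exact .symm (.comp (ihx hx e dx).symm (ihy hy e dy).symm hc)

/-! ### The `ω`-category of terms -/

/-- Well-formed terms, up to the relation of denoting the same cell. -/
instance setoid : Setoid {x : OneTerm.{u} // Rel x x} where
  r x y := Rel x.1 y.1
  iseqv := ⟨fun x => x.2, fun h => h.symm, fun h h' => h.trans h'⟩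

/-- The cells of `𝟙`. -/
def Cell : Type u := Quotient setoid.{u}

/-- The cell denoted by a well-formed term. -/
def mk (x : OneTerm.{u}) (h : Rel x x) : Cell.{u} := Quotient.mk setoid ⟨x, h⟩

theorem mk_eq_mk {x y : OneTerm.{u}} {hx : Rel x x} {hy : Rel y y} :
    mk x hx = mk y hy ↔ Rel x y := Quotient.eq (r := setoid)

theorem exists_mk (c : Cell.{u}) : ∃ x h, mk x h = c := by
  obtain ⟨⟨x, h⟩, rfl⟩ := Quotient.exists_rep c
  exact ⟨x, h, rfl⟩

/-- Boundaries of cells. -/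
def cellBd (e : Bool) (k : ℕ) (c : Cell.{u}) : Cell.{u} :=
  Quotient.map (fun x => ⟨bd e k x.1, x.2.bd e k⟩) (fun _ _ h => Rel.bd h e k) c

theorem cellBd_mk (e : Bool) (k : ℕ) (x : OneTerm.{u}) (h : Rel x x) :
    cellBd e k (mk x h) = mk (bd e k x) (h.bd e k) := rfl

open Classical in
/-- Composition of cells, with the junk value `a` where `a` and `b` are not composable. -/
noncomputable def cellComp (k : ℕ) (a b : Cell.{u}) : Cell.{u} :=
  if h : Rel (bd false k a.out.1) (bd true k b.out.1) then
    mk (comp k a.out.1 b.out.1) (.comp a.out.2 b.out.2 h) else a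

theorem rel_out (x : OneTerm.{u}) (h : Rel x x) : Rel (mk x h).out.1 x :=
  Quotient.mk_out (s := setoid) ⟨x, h⟩

theorem cellComp_mk {k : ℕ} {x y : OneTerm.{u}} (hx : Rel x x) (hy : Rel y y)
    (h : Rel (bd false k x) (bd true k y)) :
    cellComp k (mk x hx) (mk y hy) = mk (comp k x y) (.comp hx hy h) := by
  have h1 := rel_out x hx
  have h2 := rel_out y hy
  have h' := ((h1.bd false k).trans h).trans (h2.bd true k).symm
  rw [cellComp, dif_pos h', mk_eq_mk]
  exact .comp h1 h2 h'

theorem cellBd_cellBd_of_le {e e' : Bool} {k j : ℕ} (h : k ≤ j) (c : Cell.{u}) :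
    cellBd e' j (cellBd e k c) = cellBd e k c := by
  obtain ⟨x, hx, rfl⟩ := exists_mk c
  simp only [cellBd_mk, bd_bd_of_le h]

theorem cellBd_cellBd_of_lt {e e' : Bool} {k j : ℕ} (h : k < j) (c : Cell.{u}) :
    cellBd e k (cellBd e' j c) = cellBd e k c := by
  obtain ⟨x, hx, rfl⟩ := exists_mk c
  simp only [cellBd_mk, mk_eq_mk]
  exact hx.glob _ _ _ _ h

theorem cellBd_cellComp {e : Bool} {k : ℕ} {a b : Cell.{u}}
    (h : cellBd false k a = cellBd true k b) :
    cellBd e k (cellComp k a b) = cellBd e k (cond e a b) := by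
  obtain ⟨x, hx, rfl⟩ := exists_mk a
  obtain ⟨y, hy, rfl⟩ := exists_mk b
  simp only [cellBd_mk, mk_eq_mk] at h
  rw [cellComp_mk hx hy h]
  cases e <;> simp [cellBd_mk, bd_comp_of_le le_rfl]

theorem cellBd_cellComp_of_lt {e : Bool} {k j : ℕ} (hkj : k < j) {a b : Cell.{u}}
    (h : cellBd false k a = cellBd true k b) :
    cellBd e j (cellComp k a b) = cellComp k (cellBd e j a) (cellBd e j b) := by
  obtain ⟨x, hx, rfl⟩ := exists_mk a
  obtain ⟨y, hy, rfl⟩ := exists_mk b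
  simp only [cellBd_mk, mk_eq_mk] at h
  rw [cellComp_mk hx hy h, cellBd_mk, cellBd_mk, cellBd_mk,
    cellComp_mk _ _ (hx.glob.comp_bd hy.glob h e hkj), mk_eq_mk, bd_comp_of_lt hkj]
  exact .comp (hx.bd _ _) (hy.bd _ _) (hx.glob.comp_bd hy.glob h e hkj)

theorem cellComp_src (k : ℕ) (a : Cell.{u}) : cellComp k a (cellBd false k a) = a := by
  obtain ⟨x, hx, rfl⟩ := exists_mk a
  have h : Rel (bd false k x) (bd true k (bd false k x)) := by
    rw [bd_bd_of_le le_rfl]; exact hx.bd _ _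
  rw [cellBd_mk, cellComp_mk _ _ h, mk_eq_mk]
  exact .comp_src (.comp hx (hx.bd _ _) h) hx

theorem tgt_cellComp (k : ℕ) (a : Cell.{u}) : cellComp k (cellBd true k a) a = a := by
  obtain ⟨x, hx, rfl⟩ := exists_mk a
  have h : Rel (bd false k (bd true k x)) (bd true k x) := by
    rw [bd_bd_of_le le_rfl]; exact hx.bd _ _
  rw [cellBd_mk, cellComp_mk _ _ h, mk_eq_mk]
  exact .tgt_comp (.comp (hx.bd _ _) hx h) hx

theorem cellComp_assoc {k : ℕ} {a b c : Cell.{u}} (h : cellBd false k a = cellBd true k b)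
    (h' : cellBd false k b = cellBd true k c) :
    cellComp k (cellComp k a b) c = cellComp k a (cellComp k b c) := by
  obtain ⟨x, hx, rfl⟩ := exists_mk a
  obtain ⟨y, hy, rfl⟩ := exists_mk b
  obtain ⟨z, hz, rfl⟩ := exists_mk c
  simp only [cellBd_mk, mk_eq_mk] at h h'
  have h1 : Rel (bd false k (comp k x y)) (bd true k z) := by rwa [bd_comp_of_le le_rfl]
  have h2 : Rel (bd false k x) (bd true k (comp k y z)) := by rwa [bd_comp_of_le le_rfl]
  rw [cellComp_mk hx hy h, cellComp_mk hy hz h', cellComp_mk _ _ h1, cellComp_mk _ _ h2, mk_eq_mk]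
  exact .assoc (.comp (.comp hx hy h) hz h1) (.comp hx (.comp hy hz h') h2)

theorem cellComp_exchange {m n : ℕ} (hmn : m < n) {a a' b b' : Cell.{u}}
    (ha : cellBd false n a = cellBd true n a') (hb : cellBd false n b = cellBd true n b')
    (h : cellBd false m a = cellBd true m b) :
    cellComp m (cellComp n a a') (cellComp n b b') =
      cellComp n (cellComp m a b) (cellComp m a' b') := by
  obtain ⟨x, hx, rfl⟩ := exists_mk a
  obtain ⟨x', hx', rfl⟩ := exists_mk a'
  obtain ⟨y, hy, rfl⟩ := exists_mk b
  obtain ⟨y', hy', rfl⟩ := exists_mk b'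
  simp only [cellBd_mk, mk_eq_mk] at ha hb h
  have low : ∀ {z z' : OneTerm.{u}} (_ : Rel z z) (_ : Rel z' z')
      (_ : Rel (bd false n z) (bd true n z')) (e : Bool), Rel (bd e m z) (bd e m z') :=
    fun hz hz' hc e => hz.glob.rel_bd_of_lt hz'.glob (fun e k => hc.bd e k) e hmn
  have h' : Rel (bd false m x') (bd true m y') :=
    ((low hx hx' ha false).symm.trans h).trans (low hy hy' hb true)
  have h1 : Rel (bd false m (comp n x x')) (bd true m (comp n y y')) := by
    rw [bd_comp_of_le hmn.le, bd_comp_of_le hmn.le]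
    exact (low hx hx' ha false).symm.trans h
  have h2 : Rel (bd false n (comp m x y)) (bd true n (comp m x' y')) := by
    rw [bd_comp_of_lt hmn, bd_comp_of_lt hmn]
    exact .comp ha hb (hx.glob.comp_bd hy.glob h false hmn)
  rw [cellComp_mk hx hx' ha, cellComp_mk hy hy' hb, cellComp_mk hx hy h, cellComp_mk hx' hy' h',
    cellComp_mk _ _ h1, cellComp_mk _ _ h2, mk_eq_mk]
  exact .exchange hmn (.comp (.comp hx hx' ha) (.comp hy hy' hb) h1)
    (.comp (.comp hx hy h) (.comp hx' hy' h') h2)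

theorem cellBd_mk_eq_self_iff {e : Bool} {n : ℕ} {x : OneTerm.{u}} (h : Rel x x) :
    cellBd e n (mk x h) = mk x h ↔ x.dim ≤ n := by
  rw [cellBd_mk, mk_eq_mk]
  exact ⟨fun hr => hr.dim_eq ▸ dim_bd_le e n x, h.bd_of_dim_le e⟩

/-- The strict `ω`-category `𝟙*` of cells denoted by terms. -/
noncomputable def cat : StrictOmegaCat.{u} where
  Cell := Cell.{u}
  src := cellBd false
  tgt := cellBd true
  comp k a b _ := cellComp k a b
  src_src_of_le h x := cellBd_cellBd_of_le h x
  src_tgt_of_le h x := cellBd_cellBd_of_le h x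
  tgt_src_of_le h x := cellBd_cellBd_of_le h x
  tgt_tgt_of_le h x := cellBd_cellBd_of_le h x
  src_src_of_lt h x := cellBd_cellBd_of_lt h x
  src_tgt_of_lt h x := cellBd_cellBd_of_lt h x
  tgt_src_of_lt h x := cellBd_cellBd_of_lt h x
  tgt_tgt_of_lt h x := cellBd_cellBd_of_lt h x
  src_comp _ _ _ h := cellBd_cellComp h
  tgt_comp _ _ _ h := cellBd_cellComp h
  comp_src := cellComp_src
  tgt_comp_self := tgt_cellComp
  comp_assoc _ _ _ _ h h' := cellComp_assoc h h'
  src_comp_of_lt hmn _ _ h := cellBd_cellComp_of_lt hmn h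
  tgt_comp_of_lt hmn _ _ h := cellBd_cellComp_of_lt hmn h
  exchange hmn _ _ _ _ hx hy h := cellComp_exchange hmn hx hy h
  finite_dim c := by
    obtain ⟨x, hx, rfl⟩ := exists_mk c
    exact ⟨x.dim, (cellBd_mk_eq_self_iff hx).2 le_rfl⟩

end OneTerm

/-! ### Composition as a total operation -/

namespace StrictOmegaCat

variable {C : StrictOmegaCat.{u}}

/-- The `k`-dimensional source (`e = false`) or target (`e = true`) of a cell. -/
def bd (C : StrictOmegaCat.{u}) (e : Bool) (k : ℕ) (x : C.Cell) : C.Cell :=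
  match e with
  | false => C.src k x
  | true => C.tgt k x

open Classical in
/-- Composition as a total operation, with the junk value `x` where `x` and `y` are not
composable. -/
noncomputable def pcomp (C : StrictOmegaCat.{u}) (k : ℕ) (x y : C.Cell) : C.Cell :=
  if h : C.src k x = C.tgt k y then C.comp k x y h else x

theorem pcomp_eq {k : ℕ} {x y : C.Cell} (h : C.src k x = C.tgt k y) :
    C.pcomp k x y = C.comp k x y h := dif_pos h

theorem bd_bd_self {e : Bool} {k j : ℕ} (h : k ≤ j) (x : C.Cell) :
    C.bd e k (C.bd e j x) = C.bd e k x := by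
  rcases h.lt_or_eq with h | rfl
  · cases e
    · exact C.src_src_of_lt h x
    · exact C.tgt_tgt_of_lt h x
  · cases e
    · exact C.src_src_of_le le_rfl x
    · exact C.tgt_tgt_of_le le_rfl x

theorem bd_pcomp_of_le {e : Bool} {k j : ℕ} (hj : j ≤ k) {x y : C.Cell}
    (h : C.src k x = C.tgt k y) : C.bd e j (C.pcomp k x y) = C.bd e j (cond e x y) := by
  rw [pcomp_eq h, ← bd_bd_self hj, ← bd_bd_self hj (cond e x y)]
  cases e
  · exact congrArg (C.src j) (C.src_comp k x y h)
  · exact congrArg (C.tgt j) (C.tgt_comp k x y h)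

theorem bd_composable {k j : ℕ} (hj : k < j) {x y : C.Cell} (h : C.src k x = C.tgt k y)
    (e : Bool) : C.src k (C.bd e j x) = C.tgt k (C.bd e j y) := by
  cases e
  · exact (C.src_src_of_lt hj x).trans (h.trans (C.tgt_src_of_lt hj y).symm)
  · exact (C.src_tgt_of_lt hj x).trans (h.trans (C.tgt_tgt_of_lt hj y).symm)

theorem bd_pcomp_of_lt {e : Bool} {k j : ℕ} (hj : k < j) {x y : C.Cell}
    (h : C.src k x = C.tgt k y) :
    C.bd e j (C.pcomp k x y) = C.pcomp k (C.bd e j x) (C.bd e j y) := by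
  rw [pcomp_eq h, pcomp_eq (bd_composable hj h e)]
  cases e
  · exact C.src_comp_of_lt hj x y h
  · exact C.tgt_comp_of_lt hj x y h

theorem pcomp_src (k : ℕ) (x : C.Cell) : C.pcomp k x (C.src k x) = x :=
  (pcomp_eq (C.tgt_src_of_le le_rfl x).symm).trans (C.comp_src k x)

theorem tgt_pcomp (k : ℕ) (x : C.Cell) : C.pcomp k (C.tgt k x) x = x :=
  (pcomp_eq (C.src_tgt_of_le le_rfl x)).trans (C.tgt_comp_self k x)

theorem pcomp_assoc {k : ℕ} {x y z : C.Cell} (h : C.src k x = C.tgt k y)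
    (h' : C.src k y = C.tgt k z) :
    C.pcomp k (C.pcomp k x y) z = C.pcomp k x (C.pcomp k y z) := by
  simp only [pcomp_eq h, pcomp_eq h']
  rw [pcomp_eq, pcomp_eq]
  exact C.comp_assoc k x y z h h'

theorem pcomp_exchange {m n : ℕ} (hmn : m < n) {x x' y y' : C.Cell}
    (hx : C.src n x = C.tgt n x') (hy : C.src n y = C.tgt n y') (h : C.src m x = C.tgt m y)
    (h' : C.src m x' = C.tgt m y') :
    C.pcomp m (C.pcomp n x x') (C.pcomp n y y') =
      C.pcomp n (C.pcomp m x y) (C.pcomp m x' y') := by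
  simp only [pcomp_eq h, pcomp_eq h', pcomp_eq hx, pcomp_eq hy]
  rw [pcomp_eq, pcomp_eq]
  exact C.exchange hmn x x' y y' hx hy h

theorem IsCell.bd {n : ℕ} {x : C.Cell} (h : C.IsCell n x) (e : Bool) (k : ℕ) :
    C.IsCell n (C.bd e k x) := by
  cases e
  · exact h.src k
  · exact h.tgt k

theorem isCell_bd (C : StrictOmegaCat.{u}) (e : Bool) (n : ℕ) (x : C.Cell) :
    C.IsCell n (C.bd e n x) := by
  cases e
  · exact C.src_src_of_le le_rfl x
  · exact C.src_tgt_of_le le_rfl x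

theorem IsCell.bd_eq {n : ℕ} {x : C.Cell} (h : C.IsCell n x) (e : Bool) : C.bd e n x = x := by
  cases e
  · exact h
  · exact h.tgt_eq

theorem parallel_iff {n : ℕ} {x y : C.Cell} :
    C.Parallel n x y ↔ ∀ e k, k < n → C.bd e k x = C.bd e k y := by
  cases n with
  | zero => exact ⟨fun _ _ _ h => absurd h (Nat.not_lt_zero _), fun _ => trivial⟩
  | succ n =>
    refine ⟨fun h e k hk => ?_,
      fun h => ⟨h false n (Nat.lt_succ_self n), h true n (Nat.lt_succ_self n)⟩⟩
    have hn : C.bd e n x = C.bd e n y := by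
      cases e
      · exact h.1
      · exact h.2
    rw [← bd_bd_self (Nat.le_of_lt_succ hk), hn,
      bd_bd_self (Nat.le_of_lt_succ hk)]

end StrictOmegaCat

theorem StrictOmegaFunctor.map_bd_trunc {C D : StrictOmegaCat.{u}} {n : ℕ}
    (F : StrictOmegaFunctor (C.trunc n) D) (e : Bool) (k : ℕ) {x : C.Cell} (h : C.IsCell n x) :
    F.map ⟨C.bd e k x, h.bd e k⟩ = D.bd e k (F.map ⟨x, h⟩) := by
  cases e
  · exact F.map_src k ⟨x, h⟩
  · exact F.map_tgt k ⟨x, h⟩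

namespace OneTerm

/-! ### Freeness -/

theorem cat_bd (e : Bool) (k : ℕ) (c : Cell.{u}) : cat.bd e k c = cellBd e k c := by
  cases e <;> rfl

theorem isCell_mk_iff {n : ℕ} {x : OneTerm.{u}} (h : Rel x x) :
    cat.IsCell n (mk x h) ↔ x.dim ≤ n := cellBd_mk_eq_self_iff h

/-- The `n`-generators of `𝟙`. -/
def genSet (n : ℕ) : Set Cell.{u} := {c | ∃ x h, IsGen n x ∧ mk x h = c}

section interp

variable {n : ℕ} {D : StrictOmegaCat.{u}} (F : StrictOmegaFunctor (cat.{u}.trunc n) D)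
  (φ : {c : (cat.{u}.trunc (n + 1)).Cell | c.1 ∈ genSet (n + 1)} → D.Cell)

open Classical in
/-- The value prescribed by a functor `F` on the `n`-cells and a map `φ` on the
`(n+1)`-generators at a term denoting an `n`-cell or an `(n+1)`-generator; a junk value at all
other terms. -/
noncomputable def genVal (x : OneTerm.{u}) : D.Cell :=
  if h : ∃ h : Rel x x, cat.IsCell n (mk x h) then F.map ⟨mk x h.1, h.2⟩
  else if h : ∃ h : Rel x x, cat.IsCell (n + 1) (mk x h) ∧ mk x h ∈ genSet (n + 1) then
    φ ⟨⟨mk x h.1, h.2.1⟩, h.2.2⟩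
  else F.map ⟨mk OneTerm.pt .pt, rfl⟩

/-- The value of a term in `D`, computed from the values at generators. -/
noncomputable def interp : OneTerm.{u} → D.Cell
  | pt => genVal F φ pt
  | gen m u v => genVal F φ (gen m u v)
  | comp k x y => D.pcomp k (interp x) (interp y)

theorem interp_of_dim_le {x : OneTerm.{u}} (h : Rel x x) (hd : x.dim ≤ n) :
    interp F φ x = F.map ⟨mk x h, (isCell_mk_iff h).2 hd⟩ := by
  induction x with
  | pt => exact dif_pos ⟨h, (isCell_mk_iff h).2 hd⟩
  | gen m u v => exact dif_pos ⟨h, (isCell_mk_iff h).2 hd⟩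
  | comp k x y ihx ihy =>
    obtain ⟨hx, hy⟩ := h.inv.1
    have dx : x.dim ≤ n := (le_max_left _ _).trans hd
    have dy : y.dim ≤ n := (le_max_right _ _).trans hd
    have hr := h.composable.1 _ _ _ rfl
    have hc : (cat.trunc n).src k ⟨mk x hx, (isCell_mk_iff hx).2 dx⟩ =
        (cat.trunc n).tgt k ⟨mk y hy, (isCell_mk_iff hy).2 dy⟩ :=
      Subtype.ext (mk_eq_mk.2 hr)
    have hF := F.map_comp k _ _ hc
    rw [interp, ihx hx dx, ihy hy dy, StrictOmegaCat.pcomp_eq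
      ((F.map_src k _).symm.trans ((congrArg F.map hc).trans (F.map_tgt k _))), ← hF]
    exact congrArg F.map (Subtype.ext (cellComp_mk hx hy hr))

theorem interp_gen {x : OneTerm.{u}} (h : Rel x x) (hx : IsGen (n + 1) x) :
    interp F φ x = φ ⟨⟨mk x h, (isCell_mk_iff h).2 hx.dim_eq.le⟩, x, h, hx, rfl⟩ := by
  have hn : ¬ ∃ h : Rel x x, cat.IsCell n (mk x h) := fun ⟨h, hc⟩ =>
    absurd (((isCell_mk_iff h).1 hc).trans_lt (Nat.lt_succ_self n)) (hx.dim_eq.not_lt)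
  have hg : genVal F φ x = φ ⟨⟨mk x h, (isCell_mk_iff h).2 hx.dim_eq.le⟩, x, h, hx, rfl⟩ := by
    rw [genVal, dif_neg hn,
      dif_pos ⟨h, (isCell_mk_iff h).2 hx.dim_eq.le, x, h, hx, rfl⟩]
  cases x with
  | gen m u v => exact hg
  | pt => exact hx.elim
  | comp => exact hx.elim

/-- All composites occurring in the value of a term are defined. -/
def Defined : OneTerm.{u} → Prop
  | comp k x y => Defined x ∧ Defined y ∧ D.src k (interp F φ x) = D.tgt k (interp F φ y)
  | _ => True

/-- The value of a term is compatible with boundaries. -/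
def BdCompat (x : OneTerm.{u}) : Prop :=
  ∀ e k, interp F φ (bd e k x) = D.bd e k (interp F φ x)

variable {F φ}

theorem BdCompat.comp {x y : OneTerm.{u}} {p : ℕ} (hx : BdCompat F φ x) (hy : BdCompat F φ y)
    (h : D.src p (interp F φ x) = D.tgt p (interp F φ y)) : BdCompat F φ (comp p x y) := by
  intro e k
  rcases le_or_gt k p with hk | hk
  · rw [bd_comp_of_le hk, interp, StrictOmegaCat.bd_pcomp_of_le hk h]
    cases e
    · exact hy _ _
    · exact hx _ _
  · rw [bd_comp_of_lt hk, interp, interp, StrictOmegaCat.bd_pcomp_of_lt hk h, hx, hy]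

theorem BdCompat.of_dim_le {x : OneTerm.{u}} (h : Rel x x) (hd : x.dim ≤ n) :
    BdCompat F φ x := by
  intro e k
  rw [interp_of_dim_le F φ h hd, interp_of_dim_le F φ (h.bd e k) ((dim_bd_le_dim e k x).trans hd),
    ← F.map_bd_trunc e k ((isCell_mk_iff h).2 hd)]
  congr 2
  exact (cat_bd e k (mk x h)).symm

theorem BdCompat.gen
    (hD : D.IsNCategory (n + 1))
    (hφ : ∀ e g, D.bd e n (φ g) = F.map ⟨cat.bd e n g.1.1, cat.isCell_bd e n _⟩)
    {m : ℕ} {u v : OneTerm.{u}} (h : Rel (gen m u v) (gen m u v)) (hm : m ≤ n) :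
    BdCompat F φ (gen m u v) := by
  rcases hm.lt_or_eq with hm | rfl
  · exact .of_dim_le h hm
  intro e k
  rcases le_or_gt k m with hk | hk
  · have hc : cat.IsCell m (mk (OneTerm.bd e m (OneTerm.gen m u v)) (h.bd e m)) :=
      (isCell_mk_iff _).2 (dim_bd_le _ _ _)
    have hb : D.bd e m (interp F φ (OneTerm.gen m u v)) = F.map ⟨_, hc⟩ := by
      rw [interp_gen F φ h rfl, hφ]
      exact congrArg F.map (Subtype.ext (cat_bd e m _))
    rw [← StrictOmegaCat.bd_bd_self hk, hb, ← F.map_bd_trunc e k hc,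
      interp_of_dim_le F φ (h.bd e k) ((dim_bd_le _ _ _).trans hk)]
    congr 2
    refine Eq.trans (mk_eq_mk.2 ?_) (cat_bd e k (mk _ (h.bd e m))).symm
    rw [OneTerm.bd_bd_self hk]
    exact h.bd e k
  · rw [bd_gen_of_lt hk]
    exact ((StrictOmegaCat.IsCell.mono hk (hD _)).bd_eq e).symm

/-- Soundness: related terms of dimension at most `n + 1` have the same value. -/
theorem Rel.interp_eq
    (hD : D.IsNCategory (n + 1))
    (hφ : ∀ e g, D.bd e n (φ g) = F.map ⟨cat.bd e n g.1.1, cat.isCell_bd e n _⟩)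
    {x y : OneTerm.{u}} (h : Rel x y) (hd : x.dim ≤ n + 1) :
    (Defined F φ x ∧ BdCompat F φ x) ∧ (Defined F φ y ∧ BdCompat F φ y) ∧
      interp F φ x = interp F φ y := by
  induction h with
  | pt =>
    have h : BdCompat F φ OneTerm.pt := .of_dim_le .pt (Nat.zero_le n)
    exact ⟨⟨trivial, h⟩, ⟨trivial, h⟩, rfl⟩
  | @gen m u u' v v' hu hv du du' gv gv' hp _ _ _ =>
    have h : Rel (OneTerm.gen m u v) (OneTerm.gen m u' v') := .gen hu hv du du' gv gv' hp
    have hm : m ≤ n := Nat.le_of_succ_le_succ hd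
    refine ⟨⟨trivial, .gen hD hφ h.left hm⟩, ⟨trivial, .gen hD hφ h.right hm⟩, ?_⟩
    have he : mk _ h.left = mk _ h.right := mk_eq_mk.2 h
    rcases hm.lt_or_eq with hm | rfl
    · rw [interp_of_dim_le F φ h.left hm, interp_of_dim_le F φ h.right hm]
      congr 2
    · rw [interp_gen F φ h.left rfl, interp_gen F φ h.right rfl]
      congr 3
  | @comp k x x' y y' hx hy h ihx ihy ih =>
    obtain ⟨hx1, hx2, hx3⟩ := ihx ((le_max_left _ _).trans hd)
    obtain ⟨hy1, hy2, hy3⟩ := ihy ((le_max_right _ _).trans hd)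
    have hb := (ih ((dim_bd_le_dim _ _ _).trans ((le_max_left _ _).trans hd))).2.2
    rw [hx1.2, hy1.2] at hb
    have hb' : D.src k (interp F φ x') = D.tgt k (interp F φ y') := by rw [← hx3, ← hy3]; exact hb
    refine ⟨⟨⟨hx1.1, hy1.1, hb⟩, hx1.2.comp hy1.2 hb⟩,
      ⟨⟨hx2.1, hy2.1, hb'⟩, hx2.2.comp hy2.2 hb'⟩, ?_⟩
    rw [interp, interp, hx3, hy3]
  | symm h ih =>
    obtain ⟨h1, h2, h3⟩ := ih (h.dim_eq.trans_le hd)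
    exact ⟨h2, h1, h3.symm⟩
  | trans h _ ih ih' =>
    obtain ⟨h1, h2, h3⟩ := ih hd
    obtain ⟨h4, h5, h6⟩ := ih' (h.dim_eq.symm.trans_le hd)
    exact ⟨h1, h5, h3.trans h6⟩
  | @comp_src k x _ _ ihl ih =>
    have h1 := (ih ((le_max_left _ _).trans hd)).1
    refine ⟨(ihl hd).1, h1, ?_⟩
    rw [interp, h1.2]
    exact StrictOmegaCat.pcomp_src k _
  | @tgt_comp k x _ _ ihl ih =>
    have h1 := (ih ((le_max_right _ _).trans hd)).1
    refine ⟨(ihl hd).1, h1, ?_⟩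
    rw [interp, h1.2]
    exact StrictOmegaCat.tgt_pcomp k _
  | @assoc k x y z _ _ ihl ihr =>
    have hl := (ihl hd).1
    have hr := (ihr ((max_assoc _ _ _).symm.trans_le hd)).1
    exact ⟨hl, hr, StrictOmegaCat.pcomp_assoc hl.1.1.2.2 hr.1.2.1.2.2⟩
  | @exchange m n x x' y y' hmn _ _ ihl ihr =>
    have hl := (ihl hd).1
    have hr := (ihr ((max_max_max_comm _ _ _ _).trans_le hd)).1
    exact ⟨hl, hr, StrictOmegaCat.pcomp_exchange hmn hl.1.1.2.2 hl.1.2.1.2.2 hr.1.1.2.2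
      hr.1.2.1.2.2⟩

end interp

/-- A functor on the `(n+1)`-cells of `𝟙` is determined by its values on the `n`-cells and on the
`(n+1)`-generators. -/
theorem functor_ext {n : ℕ} {D : StrictOmegaCat.{u}}
    {G H : StrictOmegaFunctor (cat.{u}.trunc (n + 1)) D}
    (h : ∀ x : (cat.trunc n).Cell, G.map (cat.incl n x) = H.map (cat.incl n x))
    (h' : ∀ x : (cat.trunc (n + 1)).Cell, x.1 ∈ genSet (n + 1) → G.map x = H.map x) : G = H := by
  have key : ∀ (x : OneTerm.{u}) (hx : Rel x x) (hd : x.dim ≤ n + 1),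
      G.map ⟨mk x hx, (isCell_mk_iff hx).2 hd⟩ = H.map ⟨mk x hx, (isCell_mk_iff hx).2 hd⟩ := by
    intro x hx hd
    induction x with
    | pt => exact h ⟨mk pt hx, (isCell_mk_iff hx).2 (Nat.zero_le n)⟩
    | gen m u v =>
      have hm : m ≤ n := Nat.le_of_succ_le_succ hd
      rcases hm.lt_or_eq with hm | rfl
      · exact h ⟨mk (gen m u v) hx, (isCell_mk_iff hx).2 hm⟩
      · exact h' _ ⟨gen m u v, hx, rfl, rfl⟩
    | comp k x y ihx ihy =>
      obtain ⟨hx', hy'⟩ := hx.inv.1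
      have hr := hx.composable.1 _ _ _ rfl
      have dx : x.dim ≤ n + 1 := (le_max_left _ _).trans hd
      have dy : y.dim ≤ n + 1 := (le_max_right _ _).trans hd
      have hc : (cat.trunc (n + 1)).src k ⟨mk x hx', (isCell_mk_iff hx').2 dx⟩ =
          (cat.trunc (n + 1)).tgt k ⟨mk y hy', (isCell_mk_iff hy').2 dy⟩ :=
        Subtype.ext (mk_eq_mk.2 hr)
      have he : (⟨mk (comp k x y) hx, (isCell_mk_iff hx).2 hd⟩ : (cat.trunc (n + 1)).Cell) =
          (cat.trunc (n + 1)).comp k _ _ hc := Subtype.ext (cellComp_mk hx' hy' hr).symm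
      rw [he]
      refine (G.map_comp _ _ _ hc).trans (Eq.trans ?_ (H.map_comp _ _ _ hc).symm)
      congr 1
      · exact ihx hx' dx
      · exact ihy hy' dy
  ext ⟨c, hc⟩
  obtain ⟨x, hx, rfl⟩ := exists_mk c
  exact key x hx ((isCell_mk_iff hx).1 hc)

theorem cat_freelyGenerated (n : ℕ) :
    cat.{u}.FreelyGenerated n {x | x.1 ∈ genSet (n + 1)} := by
  intro D hD F φ hs ht
  have hφ : ∀ e g, D.bd e n (φ g) = F.map ⟨cat.bd e n g.1.1, cat.isCell_bd e n _⟩ := by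
    rintro (_ | _) g
    · exact hs g
    · exact ht g
  let val : Cell.{u} → D.Cell := fun c => interp F φ c.out.1
  have val_mk : ∀ (x : OneTerm.{u}) (h : Rel x x), x.dim ≤ n + 1 →
      val (mk x h) = interp F φ x := fun x h hd =>
    (Rel.interp_eq hD hφ (rel_out x h) ((rel_out x h).dim_eq.trans_le hd)).2.2
  have val_bd : ∀ (e : Bool) (k : ℕ) (c : Cell.{u}), cat.IsCell (n + 1) c →
      val (cellBd e k c) = D.bd e k (val c) := by
    intro e k c hc
    obtain ⟨x, hx, rfl⟩ := exists_mk c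
    have hd := (isCell_mk_iff hx).1 hc
    rw [cellBd_mk, val_mk x hx hd, val_mk _ _ ((dim_bd_le_dim e k x).trans hd)]
    exact (Rel.interp_eq hD hφ hx hd).1.2 e k
  have val_cell : ∀ (c : Cell.{u}) (hc : cat.IsCell n c), val c = F.map ⟨c, hc⟩ := by
    intro c hc
    obtain ⟨x, hx, rfl⟩ := exists_mk c
    have hd := (isCell_mk_iff hx).1 hc
    exact (val_mk x hx (hd.trans (Nat.le_succ n))).trans (interp_of_dim_le F φ hx hd)
  have val_gen : ∀ (c : Cell.{u}) (hc : cat.IsCell (n + 1) c) (hg : c ∈ genSet (n + 1)),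
      val c = φ ⟨⟨c, hc⟩, hg⟩ := by
    rintro c hc ⟨x, hx, hg, rfl⟩
    exact (val_mk x hx hg.dim_eq.le).trans (interp_gen F φ hx hg)
  let H : StrictOmegaFunctor (cat.{u}.trunc (n + 1)) D :=
    { map := fun c => val c.1
      map_src := fun k c => val_bd false k c.1 c.2
      map_tgt := fun k c => val_bd true k c.1 c.2
      map_comp := by
        rintro k ⟨a, ha⟩ ⟨b, hb⟩ h
        obtain ⟨x, hx, rfl⟩ := exists_mk a
        obtain ⟨y, hy, rfl⟩ := exists_mk b
        have hr : Rel (bd false k x) (bd true k y) := mk_eq_mk.1 (congrArg Subtype.val h)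
        have dx := (isCell_mk_iff hx).1 ha
        have dy := (isCell_mk_iff hy).1 hb
        refine Eq.trans (congrArg val (cellComp_mk hx hy hr)) ?_
        rw [val_mk (comp k x y) _ (max_le dx dy), interp, ← val_mk x hx dx, ← val_mk y hy dy]
        exact StrictOmegaCat.pcomp_eq _ }
  refine ⟨H, ⟨fun x => val_cell x.1 x.2, fun g => val_gen g.1.1 g.1.2 g.2⟩, fun G hG => ?_⟩
  exact functor_ext (fun x => (hG.1 x).trans (val_cell x.1 x.2).symm)
    fun x hx => (hG.2 ⟨x, hx⟩).trans (val_gen x.1 x.2 hx).symm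

end OneTerm

/-! ### The polygraph `𝟙` -/

/-- A cell parallel to a many-to-one cell is many-to-one. -/
theorem Polygraph.IsManyToOneCell.of_parallel {P : Polygraph.{u}} {n : ℕ} {u v : P.cat.Cell}
    (hv : P.IsManyToOneCell n v) (hu : P.cat.IsCell n u) (h : P.cat.Parallel n u v) :
    P.IsManyToOneCell n u := by
  cases n with
  | zero => exact hu
  | succ n => exact ⟨hu, h.2 ▸ hv.2⟩

namespace OneTerm

/-- Well-formed generators have parallel source and target. -/
theorem Rel.gen_parallel {n : ℕ} {u v : OneTerm.{u}}
    (h : Rel (OneTerm.gen n u v) (OneTerm.gen n u v)) (e : Bool) {k : ℕ} (hk : k < n) :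
    Rel (OneTerm.bd e k u) (OneTerm.bd e k v) := by
  have h1 := h.glob e false k n hk
  have h2 := h.glob e true k n hk
  rw [bd_gen_of_le le_rfl, bd_gen_of_le hk.le] at h1 h2
  obtain ⟨hu, hv, -, -⟩ := h.inv.1
  exact ((hu.glob _ _ _ _ hk).symm.trans (h1.trans h2.symm)).trans (hv.glob _ _ _ _ hk)

theorem Rel.pt_of_dim_eq_zero {x : OneTerm.{u}} (h : Rel x x) (hd : x.dim ≤ 0) :
    Rel OneTerm.pt x := by
  have := h.bd_of_dim_le false hd
  rwa [bd_zero] at this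

/-- The polygraph `𝟙`. -/
noncomputable def polygraph : Polygraph.{u} where
  cat := cat
  gen := genSet
  isCell_of_mem_gen := by
    rintro n _ ⟨x, hx, hg, rfl⟩
    exact (isCell_mk_iff hx).2 hg.dim_eq.le
  mem_gen_zero c hc := by
    obtain ⟨x, hx, rfl⟩ := exists_mk c
    exact ⟨pt, .pt, trivial, mk_eq_mk.2 (hx.pt_of_dim_eq_zero ((isCell_mk_iff hx).1 hc))⟩
  free := cat_freelyGenerated

theorem polygraph_isManyToOneCell {n : ℕ} {v : Cell.{u}} (hv : v ∈ genSet n) :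
    polygraph.IsManyToOneCell n v := by
  obtain ⟨x, hx, hg, rfl⟩ := hv
  cases n with
  | zero => exact (isCell_mk_iff hx).2 hg.dim_eq.le
  | succ n =>
    refine ⟨(isCell_mk_iff hx).2 hg.dim_eq.le, ?_⟩
    cases x with
    | pt => exact hg.elim
    | comp => exact hg.elim
    | gen m a b =>
      obtain rfl : m = n := hg
      obtain ⟨-, hb, -, gb⟩ := hx.inv.1
      refine ⟨b, hb, gb, mk_eq_mk.2 ?_⟩
      rw [bd_gen_of_le le_rfl, cond_true, gb.bd_eq true le_rfl]
      exact hb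

theorem polygraph_isOne : polygraph.{u}.IsOne where
  existsUnique_gen_zero := by
    refine ⟨mk pt .pt, ⟨pt, .pt, trivial, rfl⟩, ?_⟩
    rintro _ ⟨x, hx, hg, rfl⟩
    exact mk_eq_mk.2 (hx.pt_of_dim_eq_zero hg.dim_eq.le).symm
  bijOn_gen_succ n := by
    have bd_gen : ∀ {a b : OneTerm.{u}} (h : Rel (gen n a b) (gen n a b)),
        cellBd false n (mk _ h) = mk a h.inv.1.1 ∧ cellBd true n (mk _ h) = mk b h.inv.1.2.1 := by
      intro a b h
      obtain ⟨ha, hb, da, gb⟩ := h.inv.1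
      constructor
      · rw [cellBd_mk, mk_eq_mk, bd_gen_of_le le_rfl]
        exact ha.bd_of_dim_le false da
      · rw [cellBd_mk, mk_eq_mk, bd_gen_of_le le_rfl]
        exact hb.bd_of_dim_le true gb.dim_eq.le
    have isGen : ∀ {x : OneTerm.{u}}, IsGen (n + 1) x → ∃ a b, x = gen n a b := by
      intro x hx
      cases x with
      | pt => exact hx.elim
      | comp => exact hx.elim
      | gen m a b => exact ⟨a, b, congrArg (gen · a b) hx⟩
    refine ⟨?_, ?_, ?_⟩
    · rintro _ ⟨x, hx, hg, rfl⟩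
      obtain ⟨a, b, rfl⟩ := isGen hg
      obtain ⟨ha, hb, da, gb⟩ := hx.inv.1
      have hp : polygraph.cat.Parallel n (mk a ha) (mk b hb) :=
        StrictOmegaCat.parallel_iff.2 fun e k hk =>
          (cat_bd e k (mk a ha)).trans
            ((mk_eq_mk.2 (hx.gen_parallel e hk)).trans (cat_bd e k (mk b hb)).symm)
      have hb' : mk b hb ∈ genSet n := ⟨b, hb, gb, rfl⟩
      have hE : (polygraph.cat.src n (mk _ hx), polygraph.cat.tgt n (mk _ hx)) =
          (mk a ha, mk b hb) := Prod.ext (bd_gen hx).1 (bd_gen hx).2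
      exact Set.mem_of_eq_of_mem hE
        ⟨(polygraph_isManyToOneCell hb').of_parallel ((isCell_mk_iff ha).2 da) hp, hb', hp⟩
    · rintro _ ⟨x, hx, hg, rfl⟩ _ ⟨y, hy, hg', rfl⟩ h
      obtain ⟨a, b, rfl⟩ := isGen hg
      obtain ⟨a', b', rfl⟩ := isGen hg'
      obtain ⟨ha, hb, da, gb⟩ := hx.inv.1
      obtain ⟨ha', hb', da', gb'⟩ := hy.inv.1
      have h1 : mk a ha = mk a' ha' :=
        (bd_gen hx).1.symm.trans ((congrArg Prod.fst h).trans (bd_gen hy).1)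
      have h2 : mk b hb = mk b' hb' :=
        (bd_gen hx).2.symm.trans ((congrArg Prod.snd h).trans (bd_gen hy).2)
      exact mk_eq_mk.2 (.gen (mk_eq_mk.1 h1) (mk_eq_mk.1 h2) da da' gb gb'
        fun e k hk => hx.gen_parallel e hk)
    · rintro ⟨u, v⟩ ⟨hu, ⟨b, hb, gb, rfl⟩, hp⟩
      obtain ⟨a, ha, rfl⟩ := exists_mk u
      have hc : cat.IsCell n (mk a ha) := by
        cases n with
        | zero => exact hu
        | succ n => exact hu.1
      have da := (isCell_mk_iff ha).1 hc
      have hr : Rel (gen n a b) (gen n a b) := .gen ha hb da da gb gb fun e k hk =>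
        mk_eq_mk.1 ((cat_bd e k _).symm.trans
          ((StrictOmegaCat.parallel_iff.1 hp e k hk).trans (cat_bd e k _)))
      exact ⟨mk _ hr, ⟨_, hr, rfl, rfl⟩, Prod.ext (bd_gen hr).1 (bd_gen hr).2⟩

end OneTerm

/-! ### Terminality -/

/-- The restriction of an `ω`-functor to underlying `n`-categories. -/
def StrictOmegaFunctor.trunc {C D : StrictOmegaCat.{u}} (F : StrictOmegaFunctor C D)
    (n : ℕ) : StrictOmegaFunctor (C.trunc n) (D.trunc n) where
  map x := ⟨F.map x.1, (F.map_src n x.1).symm.trans (congrArg F.map x.2)⟩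
  map_src k x := Subtype.ext (F.map_src k x.1)
  map_tgt k x := Subtype.ext (F.map_tgt k x.1)
  map_comp k x y h := Subtype.ext (F.map_comp k x.1 y.1 (congrArg Subtype.val h))

/-- Composition of functors. -/
def StrictOmegaFunctor.trans {C D E : StrictOmegaCat.{u}} (F : StrictOmegaFunctor C D)
    (G : StrictOmegaFunctor D E) : StrictOmegaFunctor C E where
  map x := G.map (F.map x)
  map_src n x := by rw [F.map_src, G.map_src]
  map_tgt n x := by rw [F.map_tgt, G.map_tgt]
  map_comp n x y h := by rw [F.map_comp, G.map_comp]

/-- The inclusion of the underlying `n`-category into the underlying `(n+1)`-category, as a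
functor. -/
def StrictOmegaCat.inclFunctor (C : StrictOmegaCat.{u}) (n : ℕ) :
    StrictOmegaFunctor (C.trunc n) (C.trunc (n + 1)) where
  map := C.incl n
  map_src _ _ := rfl
  map_tgt _ _ := rfl
  map_comp _ _ _ _ := rfl

namespace Polygraph

/-- In a many-to-one polygraph, source and target of an `(n+1)`-generator form a pair of the kind
that indexes the `(n+1)`-generators of `𝟙`. -/
theorem IsManyToOne.src_tgt_of_mem_gen {Q : Polygraph.{u}} (hQ : Q.IsManyToOne) {n : ℕ}
    {x : Q.cat.Cell} (hx : x ∈ Q.gen (n + 1)) :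
    Q.IsManyToOneCell n (Q.cat.src n x) ∧ Q.cat.tgt n x ∈ Q.gen n ∧
      Q.cat.Parallel n (Q.cat.src n x) (Q.cat.tgt n x) := by
  have hp : Q.cat.Parallel n (Q.cat.src n x) (Q.cat.tgt n x) := by
    cases n with
    | zero => trivial
    | succ n =>
      have hn := Nat.lt_succ_self n
      exact ⟨(Q.cat.src_src_of_lt hn x).trans (Q.cat.src_tgt_of_lt hn x).symm,
        (Q.cat.tgt_src_of_lt hn x).trans (Q.cat.tgt_tgt_of_lt hn x).symm⟩
  have ht := (hQ _ x hx).2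
  exact ⟨(hQ _ _ ht).of_parallel (Q.cat.src_src_of_le le_rfl x) hp, ht, hp⟩

theorem IsOne.isManyToOne {P : Polygraph.{u}} (hP : P.IsOne) : P.IsManyToOne := by
  intro n x hx
  cases n with
  | zero => exact P.isCell_of_mem_gen 0 x hx
  | succ n => exact ⟨P.isCell_of_mem_gen _ x hx, ((hP.bijOn_gen_succ n).mapsTo hx).2.1⟩

theorem IsOne.eq_of_isCell_zero {P : Polygraph.{u}} (hP : P.IsOne) {x y : P.cat.Cell}
    (hx : P.cat.IsCell 0 x) (hy : P.cat.IsCell 0 y) : x = y :=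
  hP.existsUnique_gen_zero.unique (P.mem_gen_zero x hx) (P.mem_gen_zero y hy)

/-- Two morphisms from a polygraph to `𝟙` agree: on generators because a generator
of `𝟙` is determined by its source and target, and on other cells by freeness. -/
theorem IsOne.hom_ext {P Q : Polygraph.{u}} (hP : P.IsOne) (f g : Hom Q P) : f = g := by
  have key : ∀ n, f.toStrictOmegaFunctor.trunc n = g.toStrictOmegaFunctor.trunc n := by
    intro n
    induction n with
    | zero =>
      ext x
      exact Subtype.ext (hP.eq_of_isCell_zero ((f.toStrictOmegaFunctor.trunc 0).map x).2
        ((g.toStrictOmegaFunctor.trunc 0).map x).2)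
    | succ n ih =>
      have hc : ∀ x, Q.cat.IsCell n x → f.map x = g.map x := fun x hx =>
        congrArg (fun F : StrictOmegaFunctor (Q.cat.trunc n) (P.cat.trunc n) =>
          (F.map ⟨x, hx⟩).1) ih
      have hg : ∀ x ∈ Q.gen (n + 1), f.map x = g.map x := fun x hx => by
        refine (hP.bijOn_gen_succ n).injOn (f.map_gen _ _ hx) (g.map_gen _ _ hx)
          (Prod.ext ?_ ?_)
        · exact (f.map_src n x).symm.trans ((hc _ (Q.cat.src_src_of_le le_rfl x)).trans
            (g.map_src n x))
        · exact (f.map_tgt n x).symm.trans ((hc _ (Q.cat.src_tgt_of_le le_rfl x)).trans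
            (g.map_tgt n x))
      refine (Q.free n (P.cat.trunc (n + 1)) (fun x => Subtype.ext x.2)
        ((f.toStrictOmegaFunctor.trunc n).trans (P.cat.inclFunctor n))
        (fun x => (f.toStrictOmegaFunctor.trunc (n + 1)).map x.1)
        (fun x => Subtype.ext (f.map_src n x.1.1).symm)
        (fun x => Subtype.ext (f.map_tgt n x.1.1).symm)).unique
        ⟨fun _ => rfl, fun _ => rfl⟩
        ⟨fun x => Subtype.ext (hc x.1 x.2).symm, fun x => Subtype.ext (hg x.1.1 x.2).symm⟩
  have hm : f.map = g.map := by
    ext x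
    obtain ⟨n, hn⟩ := Q.cat.finite_dim x
    exact congrArg (fun F : StrictOmegaFunctor (Q.cat.trunc n) (P.cat.trunc n) =>
      (F.map ⟨x, hn⟩).1) (key n)
  exact Hom.ext hm

/-- A functor between underlying `n`-categories that maps `n`-generators to `n`-generators. -/
def TruncHom (Q P : Polygraph.{u}) (n : ℕ) : Type u :=
  {F : StrictOmegaFunctor (Q.cat.trunc n) (P.cat.trunc n) //
    ∀ x, x.1 ∈ Q.gen n → (F.map x).1 ∈ P.gen n}

theorem IsOne.nonempty_truncHom_zero {P : Polygraph.{u}} (hP : P.IsOne) (Q : Polygraph.{u}) :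
    Nonempty (TruncHom Q P 0) := by
  obtain ⟨p, hp, -⟩ := hP.existsUnique_gen_zero
  have hc : P.cat.IsCell 0 p := P.isCell_of_mem_gen 0 p hp
  have h : ∀ x y : (P.cat.trunc 0).Cell, x = y := fun x y =>
    Subtype.ext (hP.eq_of_isCell_zero x.2 y.2)
  exact ⟨⟨⟨fun _ => ⟨p, hc⟩, fun _ _ => h _ _, fun _ _ => h _ _, fun _ _ _ _ => h _ _⟩,
    fun _ _ => hp⟩⟩

/-- Extension of a truncated morphism by one dimension: freeness of `Q` reduces it to finding, for
each `(n+1)`-generator of `Q`, the generator of `𝟙` with the prescribed source and target. -/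
theorem IsOne.exists_extension {P Q : Polygraph.{u}} (hP : P.IsOne) (hQ : Q.IsManyToOne) {n : ℕ}
    (F : TruncHom Q P n) :
    ∃ G : TruncHom Q P (n + 1), ∀ x, G.1.map (Q.cat.incl n x) = P.cat.incl n (F.1.map x) := by
  have hpar : ∀ x y : (Q.cat.trunc n).Cell, Q.cat.Parallel n x.1 y.1 →
      P.cat.Parallel n (F.1.map x).1 (F.1.map y).1 := by
    intro x y h
    cases n with
    | zero => trivial
    | succ n =>
      constructor
      · have := congrArg F.1.map
          (Subtype.ext h.1 : (Q.cat.trunc _).src n x = (Q.cat.trunc _).src n y)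
        rw [F.1.map_src, F.1.map_src] at this
        exact congrArg Subtype.val this
      · have := congrArg F.1.map
          (Subtype.ext h.2 : (Q.cat.trunc _).tgt n x = (Q.cat.trunc _).tgt n y)
        rw [F.1.map_tgt, F.1.map_tgt] at this
        exact congrArg Subtype.val this
  have hex : ∀ x : {x : (Q.cat.trunc (n + 1)).Cell | x.1 ∈ Q.gen (n + 1)}, ∃ y ∈ P.gen (n + 1),
      P.cat.src n y = (F.1.map ⟨Q.cat.src n x.1.1, Q.cat.src_src_of_le le_rfl _⟩).1 ∧
      P.cat.tgt n y = (F.1.map ⟨Q.cat.tgt n x.1.1, Q.cat.src_tgt_of_le le_rfl _⟩).1 := by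
    rintro ⟨⟨x, hxc⟩, hx⟩
    obtain ⟨-, ht, hp⟩ := hQ.src_tgt_of_mem_gen hx
    have hv := F.2 ⟨Q.cat.tgt n x, Q.cat.src_tgt_of_le le_rfl _⟩ ht
    have hp' := hpar ⟨Q.cat.src n x, Q.cat.src_src_of_le le_rfl _⟩
      ⟨Q.cat.tgt n x, Q.cat.src_tgt_of_le le_rfl _⟩ hp
    obtain ⟨y, hy, he⟩ := (hP.bijOn_gen_succ n).surjOn
      (show (_, _) ∈ {p : P.cat.Cell × P.cat.Cell | _} from
        ⟨(hP.isManyToOne n _ hv).of_parallel (F.1.map _).2 hp', hv, hp'⟩)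
    exact ⟨y, hy, congrArg Prod.fst he, congrArg Prod.snd he⟩
  choose φ hφ hs ht using hex
  obtain ⟨G, ⟨hG, hG'⟩, -⟩ := Q.free n (P.cat.trunc (n + 1)) (fun x => Subtype.ext x.2)
    (F.1.trans (P.cat.inclFunctor n))
    (fun x => ⟨φ x, P.isCell_of_mem_gen _ _ (hφ x)⟩)
    (fun x => Subtype.ext (hs x)) (fun x => Subtype.ext (ht x))
  refine ⟨⟨G, fun x hx => ?_⟩, hG⟩
  rw [hG' ⟨x, hx⟩]
  exact hφ ⟨x, hx⟩

theorem IsOne.nonempty_hom {P Q : Polygraph.{u}} (hP : P.IsOne) (hQ : Q.IsManyToOne) :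
    Nonempty (Hom Q P) := by
  obtain ⟨F0⟩ := hP.nonempty_truncHom_zero Q
  choose ext hext using fun n => hP.exists_extension hQ (n := n)
  let F : ∀ n, TruncHom Q P n := fun n => Nat.rec F0 ext n
  have hF : ∀ n m (hnm : n ≤ m) (x : Q.cat.Cell) (hx : Q.cat.IsCell n x),
      ((F m).1.map ⟨x, hx.mono hnm⟩).1 = ((F n).1.map ⟨x, hx⟩).1 := by
    intro n m hnm x hx
    induction m, hnm using Nat.le_induction with
    | base => rfl
    | succ m hnm ih =>
      exact (congrArg Subtype.val (hext m (F m) ⟨x, hx.mono hnm⟩)).trans ih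
  choose N hN using Q.cat.finite_dim
  let f : Q.cat.Cell → P.cat.Cell := fun x => ((F (N x)).1.map ⟨x, hN x⟩).1
  have hf : ∀ n x (hx : Q.cat.IsCell n x), f x = ((F n).1.map ⟨x, hx⟩).1 := by
    intro n x hx
    rcases le_total n (N x) with h | h
    · exact hF n (N x) h x hx
    · exact (hF (N x) n h x (hN x)).symm
  refine ⟨⟨⟨f, fun n x => ?_, fun n x => ?_, fun n x y h => ?_⟩, fun n x hx => ?_⟩⟩
  · rw [hf _ _ (StrictOmegaCat.IsCell.src n (hN x))]
    exact congrArg Subtype.val ((F (N x)).1.map_src n ⟨x, hN x⟩)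
  · rw [hf _ _ (StrictOmegaCat.IsCell.tgt n (hN x))]
    exact congrArg Subtype.val ((F (N x)).1.map_tgt n ⟨x, hN x⟩)
  · have hx : Q.cat.IsCell (max (N x) (N y)) x :=
      StrictOmegaCat.IsCell.mono (le_max_left _ _) (hN x)
    have hy : Q.cat.IsCell (max (N x) (N y)) y :=
      StrictOmegaCat.IsCell.mono (le_max_right _ _) (hN y)
    simp only [hf _ _ hx, hf _ _ hy, hf _ _ (hx.comp n hy h)]
    exact congrArg Subtype.val
      ((F (max (N x) (N y))).1.map_comp n ⟨x, hx⟩ ⟨y, hy⟩ (Subtype.ext h))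
  · exact Set.mem_of_eq_of_mem (hf n x (Q.isCell_of_mem_gen n x hx)) ((F n).2 _ hx)

end Polygraph

theorem mainTheorem8 :
    (∃ P : Polygraph.{u}, P.IsOne) ∧
      ∀ P : Polygraph.{u}, P.IsOne →
        ∃ h : Polygraph.IsManyToOne P,
          Nonempty (Limits.IsTerminal (⟨P, h⟩ : PolMTO.{u})) := by
  refine ⟨⟨OneTerm.polygraph, OneTerm.polygraph_isOne⟩, fun P hP => ⟨hP.isManyToOne, ⟨?_⟩⟩⟩
  exact Limits.IsTerminal.ofUniqueHom
    (fun Q => ObjectProperty.homMk (hP.nonempty_hom Q.property).some)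
    (fun Q f => ObjectProperty.hom_ext _ (hP.hom_ext _ _))
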